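/- For $n \ge 0$ let $Q_n$ be the hypercube: its vertex set is $\{0,1\}^n$, and two vertices are adjacent if and only if they differ in exactly one coordinate. A set of spanning trees of a graph is called completely independent if any two distinct trees $T, T'$ of the set have no edge in common and, for any two vertices $u, v$, the path from $u$ to $v$ in $T$ and the path from $u$ to $v$ in $T'$ have no vertex in common other than $u$ and $v$. (1) For every positive integer $k$ and every integer $n \ge 6\cdot 2^k + k + 4$, the hypercube $Q_n$ has $2^k$ completely independent spanning trees, each of diameter at most $2(n+9k+11)$. (2) This bound is $(2+o(1))n$: for every $\varepsilon > 0$ there is $n_0$ such that $2(n+9k+11) \le (2+\varepsilon)n$ for all $k \ge 1$ and all $n \ge n_0$ with $n \ge 6\cdot 2^k + k + 4$. (3) Consequently $Q_n$ has $(\frac1{12}+o(1))n$ completely independent spanning trees, each of diameter at most $(2+o(1))n$: there are functions $N, D : \mathbb{N} \to \mathbb{N}$ with $N(n)/n \to \frac1{12}$ and $D(n)/n \to 2$ as $n \to \infty$ such that, for every $n$, the hypercube $Q_n$ has a set of $N(n)$ completely independent spanning trees, each of diameter at most $D(n)$. (4) This diameter is asymptotically optimal: for every $n$, every spanning tree of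 $Q_n$ has diameter at least $2n-1$. -/

import Mathlib

open Filter Topology

/-- The hypercube `Q_n`: the vertices are the 0-1 vectors of length `n`, and two of them are
adjacent when they differ in exactly one coordinate. -/
def hypercube (n : ℕ) : SimpleGraph (Fin n → Bool) where
  Adj u v := ∃! i, u i ≠ v i
  symm := ⟨fun u v h => by simpa only [ne_comm] using h⟩
  loopless := ⟨fun u h => by
    obtain ⟨i, hi, _⟩ := h
    exact hi rfl⟩

/-- `T` is a spanning tree of `G`: a tree on all the vertices of `G` whose edges are edges
of `G`. -/
def IsSpanningTree {V : Type*} (G T : SimpleGraph V) : Prop :=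
  T ≤ G ∧ T.IsTree

/-- Two (spanning) trees on the same vertex set are completely independent: they have no common
edge, and for any two vertices `u`, `v` the paths from `u` to `v` in the two trees have no common
vertex other than `u` and `v`. -/
def CompletelyIndependent {V : Type*} (T₁ T₂ : SimpleGraph V) : Prop :=
  Disjoint T₁.edgeSet T₂.edgeSet ∧
    ∀ (u v : V) (p : T₁.Walk u v) (q : T₂.Walk u v), p.IsPath → q.IsPath →
      ∀ w, w ∈ p.support → w ∈ q.support → w = u ∨ w = v

/-- A set of completely independent spanning trees of `G`: every member is a spanning tree of `G`
and any two distinct members are completely independent. -/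
def AreCISTs {V : Type*} (G : SimpleGraph V) (S : Finset (SimpleGraph V)) : Prop :=
  (∀ T ∈ S, IsSpanningTree G T) ∧
    ∀ T₁ ∈ S, ∀ T₂ ∈ S, T₁ ≠ T₂ → CompletelyIndependent T₁ T₂

/-! Colour the vertices so that each colour class is connected and dominating. The tree of colour
`j` spans the class `j` and hangs every other vertex `v` on it as a leaf, at `next j v`. Inner
vertices of different trees then have different colours, and edges are disjoint if no chosen edge is
chosen back (`exists_areCISTs_of_coloring`).

In the hypercube the colours form the group `(ZMod 2)^k`. One switch coordinate selects one of two
blocks, each holding every label twice, and the colour is the label sum of the selected block. The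
idle block can be changed freely, which connects a class with radius at most `n + 1`; the doubled
labels prevent an edge from being chosen back. Only `4 * 2 ^ k + 1 ≤ n` is needed, and the diameter
is at most `2 * (n + 2)`.

For the lower bound, every vertex marks its first tree edge towards its antipode. There are fewer
edges than vertices, so some edge is marked from both ends, and a long path runs through it. -/

namespace SimpleGraph

/-! ### Trees in general graphs -/

variable {V : Type*}

/-- An interior vertex of a path has two different neighbours. -/
theorem Walk.IsPath.exists_ne_adj_adj {G : SimpleGraph V} {u v : V} {p : G.Walk u v}
    (hp : p.IsPath) {w : V} (hw : w ∈ p.support) (hu : w ≠ u) (hv : w ≠ v) :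
    ∃ a b, a ≠ b ∧ G.Adj w a ∧ G.Adj w b := by
  induction p with
  | nil => simp_all
  | @cons u u' v h p ih =>
    rw [Walk.cons_isPath_iff] at hp
    have hw' : w ∈ p.support := by simpa [hu] using hw
    by_cases hwu : w = u'
    · subst hwu
      cases p with
      | nil => exact absurd rfl hv
      | @cons _ b _ h' q =>
        refine ⟨u, b, ?_, h.symm, h'⟩
        rintro rfl
        exact hp.2 (by simp)
    · exact ih hp.1 hw' hwu hv

/-- A vertex different from the root has a neighbour closer to the root. -/
theorem Connected.exists_adj_dist_add_one {G : SimpleGraph V} (hG : G.Connected) {v r : V}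
    (h : v ≠ r) : ∃ w, G.Adj v w ∧ G.dist w r + 1 = G.dist v r := by
  obtain ⟨p, hp⟩ := hG.exists_walk_length_eq_dist v r
  cases p with
  | nil => exact absurd rfl h
  | @cons _ w _ hvw q =>
    refine ⟨w, hvw, le_antisymm ?_ ?_⟩
    · rw [← hp, Walk.length_cons]
      exact Nat.succ_le_succ (dist_le q)
    · have h1 := hG.dist_triangle (u := v) (v := w) (w := r)
      rw [dist_eq_one_iff_adj.2 hvw] at h1
      omega

/-- A finite connected graph has a spanning tree preserving the distances from a given root. -/
theorem Connected.exists_isTree_le_dist_le [Finite V] {G : SimpleGraph V} (hG : G.Connected)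
    (r : V) : ∃ T ≤ G, T.IsTree ∧ ∀ v, T.dist v r ≤ G.dist v r := by
  classical
  have := Fintype.ofFinite V
  choose! par hadj hdist using fun v (h : v ≠ r) => hG.exists_adj_dist_add_one h
  let E : Finset (Sym2 V) := (Finset.univ.erase r).image fun v => s(v, par v)
  let T : SimpleGraph V := fromEdgeSet (E : Set (Sym2 V))
  have hT : ∀ v, v ≠ r → T.Adj v (par v) := fun v hv => by
    refine (fromEdgeSet_adj _).2 ⟨?_, (hadj v hv).ne⟩
    exact Finset.mem_coe.2 (Finset.mem_image_of_mem _ (by simpa using hv))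
  have hwalk : ∀ m v, G.dist v r = m → ∃ p : T.Walk v r, p.length = m := by
    intro m
    induction m with
    | zero =>
      intro v hv
      obtain rfl := hG.dist_eq_zero_iff.1 hv
      exact ⟨Walk.nil, rfl⟩
    | succ m ih =>
      intro v hv
      have hvr : v ≠ r := by
        rintro rfl
        simp at hv
      have := hdist v hvr
      obtain ⟨p, hp⟩ := ih (par v) (by omega)
      exact ⟨Walk.cons (hT v hvr) p, by simp [hp]⟩
  have hconn : T.Connected := by
    refine (connected_iff_exists_forall_reachable T).2 ⟨r, fun v => ?_⟩
    obtain ⟨p, _⟩ := hwalk _ v rfl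
    exact ⟨p.reverse⟩
  have hsub : T.edgeSet ⊆ E := by
    rw [edgeSet_fromEdgeSet]
    exact Set.sdiff_subset
  refine ⟨T, fun u v huv => ?_, ?_, fun v => ?_⟩
  · obtain ⟨h, _⟩ := (fromEdgeSet_adj _).1 huv
    obtain ⟨x, hx, hxe⟩ := Finset.mem_image.1 (Finset.mem_coe.1 h)
    have hxG := hadj x (Finset.ne_of_mem_erase hx)
    rw [← mem_edgeSet, hxe, mem_edgeSet] at hxG
    exact hxG
  -- One edge per non-root vertex: too few for a connected graph to contain a cycle.
  · refine isTree_iff_connected_and_card.2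
      ⟨hconn, le_antisymm ?_ hconn.card_vert_le_card_edgeSet_add_one⟩
    have h1 : Nat.card T.edgeSet ≤ E.card := by
      rw [← Set.ncard_coe_finset E]
      exact Set.ncard_le_ncard hsub (Finset.finite_toSet E)
    have h2 : E.card ≤ (Finset.univ.erase r).card := Finset.card_image_le
    rw [Finset.card_erase_of_mem (Finset.mem_univ r), Finset.card_univ] at h2
    have h3 : 0 < Fintype.card V := Fintype.card_pos_iff.2 ⟨r⟩
    rw [Nat.card_eq_fintype_card (α := V)]
    omega
  · obtain ⟨p, hp⟩ := hwalk _ v rfl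
    exact hp ▸ dist_le p

/-- The diameter is at most twice the depth from any root. -/
theorem Connected.diam_le_two_mul [Finite V] {G : SimpleGraph V} (hG : G.Connected) (r : V)
    {R : ℕ} (h : ∀ v, G.dist v r ≤ R) : G.diam ≤ 2 * R := by
  have := hG.nonempty
  obtain ⟨u, v, huv⟩ := G.exists_dist_eq_diam
  have h1 := hG.dist_triangle (u := u) (v := r) (w := v)
  have h2 := h u
  have h3 := h v
  rw [dist_comm] at h3
  omega

/-- If two vertices of a tree see each other first on the way to `x` and `y`, then their distances
to `y` and `x` add up to at most the distance of `x` and `y`. -/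
theorem IsTree.dist_add_dist_le {T : SimpleGraph V} (hT : T.IsTree) {u v x y : V}
    (huv : T.Adj u v) (hx : T.dist v x < T.dist u x) (hy : T.dist u y < T.dist v y) :
    T.dist v x + T.dist v y ≤ T.dist x y := by
  classical
  have hbr := isAcyclic_iff_forall_isBridge.1 hT.2 (T.mem_edgeSet.2 huv)
  -- A geodesic from `b` to `z` cannot visit the farther vertex `a`, so it survives deletion of the
  -- edge.
  have key : ∀ {a b z : V}, T.dist b z < T.dist a z →
      (T.deleteEdges {s(a, b)}).Reachable b z := by
    intro a b z h
    obtain ⟨p, hp⟩ := hT.1.exists_walk_length_eq_dist b z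
    refine reachable_deleteEdges_iff_exists_walk.2 ⟨p, fun he => ?_⟩
    have ha := p.fst_mem_support_of_mem_edges he
    have h1 := dist_le (p.dropUntil a ha)
    have h2 := p.length_dropUntil_le_length ha
    omega
  obtain ⟨p, hp⟩ := hT.1.exists_walk_length_eq_dist x y
  have hmem : s(u, v) ∈ p.edges := by
    by_contra hne
    have h1 : (T.deleteEdges {s(u, v)}).Reachable x y :=
      reachable_deleteEdges_iff_exists_walk.2 ⟨p, hne⟩
    have h2 := key hy
    rw [Sym2.eq_swap] at h2
    exact isBridge_iff.1 hbr ((h2.trans h1.symm).trans (key hx).symm)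
  have hv := p.snd_mem_support_of_mem_edges hmem
  have h1 := dist_le (p.takeUntil v hv)
  have h2 := dist_le (p.dropUntil v hv)
  have h3 := congrArg Walk.length (p.take_spec hv)
  rw [Walk.length_append] at h3
  rw [dist_comm] at h1
  omega

/-- The graph in which the trees belonging to the colour `j` are found: the edges of `G` inside the
colour class `j`, and an edge from every other vertex `v` to the vertex `next j v`. -/
def colorGraph {ι : Type*} (G : SimpleGraph V) (color : V → ι) (next : ι → V → V) (j : ι) :
    SimpleGraph V where
  Adj u v := G.Adj u v ∧ (color u = j ∧ color v = j ∨ color u ≠ j ∧ next j u = v ∨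
    color v ≠ j ∧ next j v = u)
  symm := ⟨fun _ _ h => ⟨h.1.symm, by tauto⟩⟩
  loopless := ⟨fun _ h => h.1.ne rfl⟩

/-- A partition into connected dominating sets of small radius, with the edges to the dominating
vertices chosen without repetition, yields completely independent spanning trees. -/
theorem exists_areCISTs_of_coloring [Finite V] [Nontrivial V] {ι : Type*} [Fintype ι]
    (G : SimpleGraph V) (color : V → ι) (next : ι → V → V) (root : ι → V) (R : ℕ)
    (hadj : ∀ j v, color v ≠ j → G.Adj v (next j v))
    (hcolor : ∀ j v, color v ≠ j → color (next j v) = j)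
    (hnext : ∀ j v, color v ≠ j → next (color v) (next j v) ≠ v)
    (hroot : ∀ j v, color v = j →
      ∃ p : (G.colorGraph color next j).Walk v (root j), p.length ≤ R) :
    ∃ S : Finset (SimpleGraph V), S.card = Fintype.card ι ∧ AreCISTs G S ∧
      ∀ T ∈ S, T.diam ≤ 2 * (R + 1) := by
  classical
  have hwalk : ∀ j v, ∃ p : (G.colorGraph color next j).Walk v (root j), p.length ≤ R + 1 := by
    intro j v
    by_cases hv : color v = j
    · obtain ⟨p, hp⟩ := hroot j v hv
      exact ⟨p, by omega⟩
    · obtain ⟨p, hp⟩ := hroot j (next j v) (hcolor j v hv)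
      exact ⟨Walk.cons ⟨hadj j v hv, Or.inr (Or.inl ⟨hv, rfl⟩)⟩ p, Nat.succ_le_succ hp⟩
  have hconn : ∀ j, (G.colorGraph color next j).Connected := fun j =>
    (connected_iff_exists_forall_reachable _).2 ⟨root j, fun v => ⟨(hwalk j v).choose.reverse⟩⟩
  choose T hle hT hdist using fun j => (hconn j).exists_isTree_le_dist_le (root j)
  -- A common edge would join colours `i` and `j` and be chosen from both ends, against `hnext`.
  have hedge : ∀ i j, i ≠ j → Disjoint (T i).edgeSet (T j).edgeSet := by
    intro i j hij
    rw [Set.disjoint_left]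
    intro e
    induction e with
    | h u v =>
      intro hi hj
      obtain ⟨-, hi⟩ := hle i hi
      obtain ⟨-, hj⟩ := hle j hj
      have := hcolor i u
      have := hcolor i v
      have := hcolor j u
      have := hcolor j v
      have := hnext i u
      have := hnext i v
      have := hnext j u
      have := hnext j v
      grind
  have hinner : ∀ (j : ι) (u v : V) (p : (T j).Walk u v), p.IsPath → ∀ w ∈ p.support,
      w ≠ u → w ≠ v → color w = j := by
    intro j u v p hp w hw hu hv
    -- A vertex `w` of another colour has `next j w` as its only neighbour.
    obtain ⟨a, b, hab, ha, hb⟩ := hp.exists_ne_adj_adj hw hu hv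
    obtain ⟨-, ha⟩ := hle j ha
    obtain ⟨-, hb⟩ := hle j hb
    have := hcolor j a
    have := hcolor j b
    grind
  have hci : ∀ i j, i ≠ j → CompletelyIndependent (T i) (T j) := by
    refine fun i j hij => ⟨hedge i j hij, fun u v p q hp hq w hwp hwq => ?_⟩
    by_contra! hne
    exact hij ((hinner i u v p hp w hwp hne.1 hne.2).symm.trans
      (hinner j u v q hq w hwq hne.1 hne.2))
  have hinj : Function.Injective T := by
    intro i j hij
    by_contra hne
    have hd := hedge i j hne
    rw [← hij, disjoint_self] at hd
    obtain ⟨u, w, h⟩ : ∃ u w, (T i).Adj u w := by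
      obtain ⟨u⟩ := (hT i).1.nonempty
      exact ⟨u, (hT i).1.preconnected.exists_adj_of_nontrivial u⟩
    rw [← mem_edgeSet, hd] at h
    exact h
  refine ⟨Finset.univ.image T, ?_, ⟨?_, ?_⟩, ?_⟩
  · rw [Finset.card_image_of_injective _ hinj, Finset.card_univ]
  · intro t ht
    obtain ⟨j, -, rfl⟩ := Finset.mem_image.1 ht
    exact ⟨(hle j).trans fun _ _ h => h.1, hT j⟩
  · intro t₁ h₁ t₂ h₂ hne
    obtain ⟨i, -, rfl⟩ := Finset.mem_image.1 h₁
    obtain ⟨j, -, rfl⟩ := Finset.mem_image.1 h₂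
    exact hci i j fun h => hne (h ▸ rfl)
  · intro t ht
    obtain ⟨j, -, rfl⟩ := Finset.mem_image.1 ht
    refine (hT j).1.diam_le_two_mul (root j) fun v => (hdist j v).trans ?_
    obtain ⟨p, hp⟩ := hwalk j v
    exact (dist_le p).trans hp

end SimpleGraph

/-! ### Distances in the hypercube and the lower bound -/

section Hypercube

variable {n : ℕ}

/-- Flipping one coordinate gives a neighbour in the hypercube. -/
theorem hypercube_adj_update {v : Fin n → Bool} {i : Fin n} {b : Bool} (h : v i ≠ b) :
    (hypercube n).Adj v (Function.update v i b) := by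
  refine ⟨i, by simpa using h, fun l hl => ?_⟩
  by_contra hne
  simp [hne] at hl

theorem hammingDist_le_length {x y : Fin n → Bool} (p : (hypercube n).Walk x y) :
    hammingDist x y ≤ p.length := by
  induction p with
  | nil => simp
  | @cons u v w h p ih =>
    have h1 : hammingDist u v = 1 := by
      obtain ⟨i, hi, hi'⟩ := h
      refine Finset.card_eq_one.2 ⟨i, ?_⟩
      ext l
      simp only [Finset.mem_filter, Finset.mem_univ, true_and, Finset.mem_singleton]
      exact ⟨hi' l, fun hl => hl ▸ hi⟩
    have h2 := hammingDist_triangle u v w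
    rw [SimpleGraph.Walk.length_cons]
    omega

/-- Every spanning tree of the hypercube has diameter at least `2 n - 1`. -/
theorem IsSpanningTree.two_mul_le_diam_add_one {T : SimpleGraph (Fin n → Bool)}
    (hT : IsSpanningTree (hypercube n) T) : 2 * n ≤ T.diam + 1 := by
  classical
  rcases Nat.eq_zero_or_pos n with rfl | hn
  · simp
  obtain ⟨hle, hT⟩ := hT
  let anti : (Fin n → Bool) → Fin n → Bool := fun v i => !v i
  have hanti : ∀ v, v ≠ anti v := fun v h => by
    have := congrFun h ⟨0, hn⟩
    simp [anti] at this
  have hfar : ∀ v, n ≤ T.dist v (anti v) := fun v => by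
    obtain ⟨p, hp⟩ := hT.1.exists_walk_length_eq_dist v (anti v)
    have h1 := hammingDist_le_length (p.mapLe hle)
    have h2 : hammingDist v (anti v) = n := by simp [hammingDist, anti]
    rw [SimpleGraph.Walk.length_map] at h1
    omega
  choose f hadj hdist using fun v => hT.1.exists_adj_dist_add_one (hanti v)
  have hcard : T.edgeFinset.card < (Finset.univ : Finset (Fin n → Bool)).card := by
    rw [Finset.card_univ, ← hT.card_edgeFinset]
    exact Nat.lt_succ_self _
  -- Pigeonhole: `2 ^ n` vertices mark only `2 ^ n - 1` edges.
  obtain ⟨u, -, v, -, huv, he⟩ := Finset.exists_ne_map_eq_of_card_lt_of_maps_to hcard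
    (f := fun v => s(v, f v)) fun v _ => by simpa using hadj v
  rw [Sym2.eq_iff] at he
  obtain ⟨h, -⟩ | ⟨hu, hv⟩ := he
  · exact absurd h huv
  have h1 := hdist u
  have h2 := hdist v
  have h3 := hadj u
  rw [hv] at h1 h3
  rw [← hu] at h2
  -- The two summands are at least `n - 1` and `n`.
  have h4 := hT.dist_add_dist_le h3 (by omega : T.dist v (anti u) < T.dist u (anti u))
    (by omega : T.dist u (anti v) < T.dist v (anti v))
  have h5 := hfar u
  have h6 := hfar v
  have h7 : T.dist (anti u) (anti v) ≤ T.diam := by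
    have := hT.1.nonempty
    exact SimpleGraph.dist_le_diam (SimpleGraph.connected_iff_ediam_ne_top.1 hT.1)
  omega

/-- Two vertices that agree outside `D` are joined by a walk of length at most `#D` through vertices
agreeing with them outside `D`. -/
theorem exists_walk_length_le_card {H : SimpleGraph (Fin n → Bool)} {P : (Fin n → Bool) → Prop}
    (hH : ∀ u v, P u → P v → (hypercube n).Adj u v → H.Adj u v) (D : Finset (Fin n))
    {a b : Fin n → Bool} (hab : ∀ i ∉ D, a i = b i) (hP : ∀ w, (∀ i ∉ D, w i = b i) → P w) :
    ∃ p : H.Walk a b, p.length ≤ D.card := by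
  induction D using Finset.induction_on generalizing a with
  | empty =>
    obtain rfl : a = b := funext fun i => hab i (Finset.notMem_empty i)
    exact ⟨SimpleGraph.Walk.nil, le_rfl⟩
  | insert i D hi ih =>
    have hne : ∀ l, l ∉ insert i D → l ≠ i ∧ l ∉ D := by simp
    have hP' : ∀ w, (∀ l ∉ D, w l = b l) → P w :=
      fun w hw => hP w fun l hl => hw l (hne l hl).2
    rw [Finset.card_insert_of_notMem hi]
    by_cases h : a i = b i
    · obtain ⟨p, hp⟩ := ih (a := a) (fun l hl => by
        by_cases hl' : l = i
        · rw [hl', h]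
        · exact hab l (by simp [hl', hl])) hP'
      exact ⟨p, hp.trans (Nat.le_succ _)⟩
    · have hagree : ∀ l ∉ D, Function.update a i (b i) l = b l := fun l hl => by
        by_cases hl' : l = i
        · subst hl'
          simp
        · simpa [hl'] using hab l (by simp [hl', hl])
      obtain ⟨p, hp⟩ := ih hagree hP'
      exact ⟨SimpleGraph.Walk.cons (hH _ _ (hP _ hab) (hP' _ hagree) (hypercube_adj_update h)) p,
        Nat.succ_le_succ hp⟩

/-! ### The colouring by label sums -/

variable {Γ : Type*}

/-- Of the two coordinates with label `d` in the selected block, the one that is flipped in order to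
add `d` to the colour. Its choice orients the squares spanned by these coordinates cyclically. -/
def switchCoord (φ : Option (Bool × Bool × Γ) ↪ Fin n) (d : Γ) (v : Fin n → Bool) : Fin n :=
  φ (some (v (φ none), xor (v (φ (some (v (φ none), false, d))))
    (v (φ (some (v (φ none), true, d)))), d))

/-- Flipping either coordinate of the pair changes their `xor`, so the other one is chosen next. -/
theorem switchCoord_update (φ : Option (Bool × Bool × Γ) ↪ Fin n) (d : Γ)
    (v : Fin n → Bool) :
    switchCoord φ d (Function.update v (switchCoord φ d v) (!v (switchCoord φ d v))) ≠
      switchCoord φ d v := by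
  simp only [switchCoord]
  cases h₁ : v (φ (some (v (φ none), false, d))) <;>
    cases h₂ : v (φ (some (v (φ none), true, d))) <;>
      simp [h₁, h₂]

variable [AddCommGroup Γ] [Fintype Γ]

/-- The sum of the labels of the nonzero coordinates in the block `b`; the coordinate
`φ (b, t, g)` carries the label `g`. -/
def blockSum (φ : Option (Bool × Bool × Γ) ↪ Fin n) (b : Bool) (v : Fin n → Bool) : Γ :=
  ∑ x : Bool × Γ, if v (φ (some (b, x))) then x.2 else 0

/-- The label sum of the block selected by the coordinate `φ none`. -/
def switchColor (φ : Option (Bool × Bool × Γ) ↪ Fin n) (v : Fin n → Bool) : Γ :=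
  blockSum φ (v (φ none)) v

/-- The neighbour of `v` that has the colour `j`. -/
def switchNext (φ : Option (Bool × Bool × Γ) ↪ Fin n) (j : Γ) (v : Fin n → Bool) :
    Fin n → Bool :=
  Function.update v (switchCoord φ (switchColor φ v + j) v)
    (!v (switchCoord φ (switchColor φ v + j) v))

theorem blockSum_congr (φ : Option (Bool × Bool × Γ) ↪ Fin n) {b : Bool} {v w : Fin n → Bool}
    (h : ∀ x, v (φ (some (b, x))) = w (φ (some (b, x)))) : blockSum φ b v = blockSum φ b w := by
  simp only [blockSum, h]

theorem blockSum_update (φ : Option (Bool × Bool × Γ) ↪ Fin n) (hΓ : ∀ g : Γ, g + g = 0)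
    (b t : Bool) (d : Γ) (v : Fin n → Bool) :
    blockSum φ b (Function.update v (φ (some (b, t, d))) (!v (φ (some (b, t, d))))) =
      blockSum φ b v + d := by
  classical
  have h : d = ∑ x : Bool × Γ, if x = (t, d) then d else 0 := by simp
  conv_rhs => rw [h]
  rw [blockSum, blockSum, ← Finset.sum_add_distrib]
  refine Finset.sum_congr rfl fun x _ => ?_
  by_cases hx : x = (t, d)
  · subst hx
    cases v (φ (some (b, t, d))) <;> simp [hΓ]
  · simp [hx]

variable (φ : Option (Bool × Bool × Γ) ↪ Fin n)

theorem switchNext_none (j : Γ) (v : Fin n → Bool) : switchNext φ j v (φ none) = v (φ none) := by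
  simp [switchNext, switchCoord]

theorem switchColor_switchNext (hΓ : ∀ g : Γ, g + g = 0) (j : Γ) (v : Fin n → Bool) :
    switchColor φ (switchNext φ j v) = j := by
  rw [switchColor, switchNext_none, switchNext, switchCoord, blockSum_update φ hΓ, ← switchColor,
    ← add_assoc, hΓ, zero_add]

theorem hypercube_adj_switchNext (j : Γ) (v : Fin n → Bool) :
    (hypercube n).Adj v (switchNext φ j v) :=
  hypercube_adj_update (by simp)

/-- The way back adds the same label but flips its other coordinate, so the first flip is not
undone. -/
theorem switchNext_switchNext_ne (hΓ : ∀ g : Γ, g + g = 0) (j : Γ) (v : Fin n → Bool) :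
    switchNext φ (switchColor φ v) (switchNext φ j v) ≠ v := by
  intro h
  have h1 := congrFun h (switchCoord φ (switchColor φ v + j) v)
  rw [switchNext, switchColor_switchNext φ hΓ, add_comm j, switchNext,
    Function.update_of_ne (switchCoord_update φ _ v).symm] at h1
  simp at h1

/-- The vertex of colour `j` that serves as the root of the tree belonging to `j`. -/
def switchRoot [DecidableEq Γ] (j : Γ) (i : Fin n) : Bool :=
  decide (∃ b, i = φ (some (b, false, j)))

/-- Both blocks of the root have sum `j`, so its colour does not depend on the switch. -/
theorem blockSum_switchRoot [DecidableEq Γ] (j : Γ) (b : Bool) :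
    blockSum φ b (switchRoot φ j) = j := by
  have h : ∀ x : Bool × Γ, (if switchRoot φ j (φ (some (b, x))) then x.2 else 0) =
      if x = (false, j) then j else 0 := by
    rintro ⟨t, g⟩
    by_cases h : (t, g) = (false, j) <;> simp_all [switchRoot]
  simp [blockSum, h]

/-- Inside its colour class, every vertex has distance at most `n + 1` from the root. -/
theorem exists_walk_switchRoot [DecidableEq Γ] {H : SimpleGraph (Fin n → Bool)} (j : Γ)
    (hH : ∀ u v, switchColor φ u = j → switchColor φ v = j → (hypercube n).Adj u v → H.Adj u v)
    (v : Fin n → Bool) (hv : switchColor φ v = j) :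
    ∃ p : H.Walk v (switchRoot φ j), p.length ≤ n + 1 := by
  classical
  set y := v (φ none) with hy
  set r := switchRoot φ j with hr
  let B : Finset (Fin n) := Finset.univ.image fun x : Bool × Γ => φ (some (y, x))
  let C : Finset (Fin n) := Finset.univ \ insert (φ none) B
  have hB : φ none ∉ B := by simp [B]
  have hnone : φ none ∉ C := by simp [C]
  have hBC : C.card + (B.card + 1) = n := by
    rw [← Finset.card_insert_of_notMem hB]
    simpa using Finset.card_sdiff_add_card_eq_card (Finset.subset_univ (insert (φ none) B))
  have hBmem : ∀ x, φ (some (y, x)) ∈ B := fun x => Finset.mem_image_of_mem _ (Finset.mem_univ x)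
  have hBmem' : ∀ x, φ (some (!y, x)) ∉ B := by simp [B]
  -- Route: set all of `C`, including the idle block, to root values; flip the switch; correct the
  -- block `B`, now idle; reset the switch if necessary. The length is at most `#C + 1 + #B + 1 = n
  -- + 1`.
  let a₁ : Fin n → Bool := fun i => if i ∈ C then r i else v i
  let a₂ : Fin n → Bool := Function.update a₁ (φ none) (!y)
  let a₃ : Fin n → Bool := Function.update r (φ none) (!y)
  have hC : ∀ x, φ (some (y, x)) ∉ C := by simp [C, hBmem]
  have hC' : ∀ x, φ (some (!y, x)) ∈ C := by simp [C, hBmem']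
  have hcol₁ : ∀ w : Fin n → Bool, (∀ i ∉ C, w i = v i) → switchColor φ w = j := by
    intro w hw
    rw [switchColor, hw _ hnone, ← hv, switchColor]
    exact blockSum_congr φ fun x => hw _ (hC x)
  have hcol₂ : ∀ w : Fin n → Bool, w (φ none) = !y → (∀ i ∈ C, w i = r i) →
      switchColor φ w = j := by
    intro w hw hw'
    rw [switchColor, hw, ← blockSum_switchRoot φ j (!y)]
    exact blockSum_congr φ fun x => hw' _ (hC' x)
  have hrcol : switchColor φ r = j := blockSum_switchRoot φ j _
  obtain ⟨p₁, hp₁⟩ := exists_walk_length_le_card hH C (a := v) (b := a₁)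
    (fun i hi => by simp [a₁, hi]) fun w hw => hcol₁ w fun i hi => by simpa [a₁, hi] using hw i hi
  have hcol₂' : ∀ w : Fin n → Bool, (∀ i ∉ B, w i = a₂ i) → switchColor φ w = j := by
    intro w hw
    refine hcol₂ w (by simpa [a₂] using hw _ hB) fun i hi => ?_
    have h1 : i ≠ φ none := fun h => hnone (h ▸ hi)
    have h2 : i ∉ B := fun h => by simp [C, h] at hi
    rw [hw i h2]
    simp [a₂, a₁, h1, hi]
  have hadj : H.Adj a₁ a₂ :=
    hH _ _ (hcol₁ _ fun i hi => by simp [a₁, hi]) (hcol₂' _ fun _ _ => rfl)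
      (hypercube_adj_update (by simp [a₁, hnone, ← hy]))
  have hagree : ∀ i ∉ B, a₂ i = a₃ i := by
    intro i hi
    by_cases h : i = φ none
    · simp [a₂, a₃, h]
    · simp [a₂, a₃, h, a₁, show i ∈ C by simp [C, h, hi]]
  obtain ⟨p₂, hp₂⟩ := exists_walk_length_le_card hH B hagree
    fun w hw => hcol₂' w fun i hi => (hw i hi).trans (hagree i hi).symm
  obtain ⟨p₃, hp₃⟩ : ∃ p : H.Walk a₃ r, p.length ≤ 1 := by
    refine exists_walk_length_le_card hH {φ none} (fun i hi => ?_) fun w hw => ?_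
    · simp [a₃, show i ≠ φ none by simpa using hi]
    · rw [← blockSum_switchRoot φ j (w (φ none)), switchColor]
      exact blockSum_congr φ fun x => hw _ (by simp)
  refine ⟨p₁.append (SimpleGraph.Walk.cons hadj (p₂.append p₃)), ?_⟩
  rw [SimpleGraph.Walk.length_append, SimpleGraph.Walk.length_cons,
    SimpleGraph.Walk.length_append]
  omega

/-- The hypercube of dimension at least `4 * 2 ^ k + 1` has `2 ^ k` completely independent spanning
trees of diameter at most `2 (n + 2)`. -/
theorem exists_areCISTs_hypercube {k n : ℕ} (h : 4 * 2 ^ k + 1 ≤ n) :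
    ∃ S : Finset (SimpleGraph (Fin n → Bool)), S.card = 2 ^ k ∧ AreCISTs (hypercube n) S ∧
      ∀ T ∈ S, T.diam ≤ 2 * (n + 2) := by
  classical
  have hcard : Fintype.card (Fin k → ZMod 2) = 2 ^ k := by simp
  obtain ⟨φ⟩ : Nonempty (Option (Bool × Bool × (Fin k → ZMod 2)) ↪ Fin n) := by
    refine Function.Embedding.nonempty_of_card_le ?_
    simp only [Fintype.card_option, Fintype.card_prod, hcard, Fintype.card_bool, Fintype.card_fin]
    omega
  have : Nonempty (Fin n) := ⟨φ none⟩
  have hΓ : ∀ g : Fin k → ZMod 2, g + g = 0 := fun g => funext fun i => CharTwo.add_self_eq_zero _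
  obtain ⟨S, hS, hS'⟩ := (hypercube n).exists_areCISTs_of_coloring (switchColor φ)
    (switchNext φ) (switchRoot φ) (n + 1) (fun j v _ => hypercube_adj_switchNext φ j v)
    (fun j v _ => switchColor_switchNext φ hΓ j v)
    (fun j v _ => switchNext_switchNext_ne φ hΓ j v)
    (fun j => exists_walk_switchRoot φ j fun _ _ hu hw ha => ⟨ha, Or.inl ⟨hu, hw⟩⟩)
  exact ⟨S, hS.trans hcard, hS'⟩

end Hypercube

/-! ### Asymptotics and conclusion -/

theorem sq_le_two_mul_two_pow (k : ℕ) : k ^ 2 ≤ 2 * 2 ^ k := by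
  induction k using Nat.strong_induction_on with
  | _ k ih =>
    rcases Nat.lt_or_ge k 4 with hk | hk
    · interval_cases k <;> norm_num
    · obtain ⟨m, rfl⟩ : ∃ m, k = m + 1 := ⟨k - 1, by omega⟩
      have := ih m (by omega)
      rw [pow_succ 2 m]
      nlinarith

theorem mainTheorem1 :
    -- `2 ^ k` completely independent spanning trees of diameter at most `2 (n + 9 k + 11)`
    (∀ k n : ℕ, 0 < k → 6 * 2 ^ k + k + 4 ≤ n →
      ∃ S : Finset (SimpleGraph (Fin n → Bool)),
        S.card = 2 ^ k ∧ AreCISTs (hypercube n) S ∧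
          ∀ T ∈ S, T.diam ≤ 2 * (n + 9 * k + 11)) ∧
    -- this bound is `(2 + o(1)) n`, uniformly in the admissible `k`
    (∀ ε : ℝ, 0 < ε → ∃ n₀ : ℕ, ∀ k n : ℕ, 0 < k → 6 * 2 ^ k + k + 4 ≤ n → n₀ ≤ n →
      2 * ((n : ℝ) + 9 * (k : ℝ) + 11) ≤ (2 + ε) * (n : ℝ)) ∧
    -- `(1/12 + o(1)) n` completely independent spanning trees of diameter at most `(2 + o(1)) n`
    (∃ N D : ℕ → ℕ,
      Tendsto (fun n : ℕ => (N n : ℝ) / (n : ℝ)) atTop (𝓝 (1 / 12)) ∧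
      Tendsto (fun n : ℕ => (D n : ℝ) / (n : ℝ)) atTop (𝓝 2) ∧
      ∀ n : ℕ, ∃ S : Finset (SimpleGraph (Fin n → Bool)),
        S.card = N n ∧ AreCISTs (hypercube n) S ∧ ∀ T ∈ S, T.diam ≤ D n) ∧
    -- asymptotic optimality: every spanning tree has diameter at least `2 n - 1`
    (∀ (n : ℕ) (T : SimpleGraph (Fin n → Bool)),
      IsSpanningTree (hypercube n) T → 2 * n ≤ T.diam + 1) := by
  refine ⟨fun k n _ h => ?_, fun ε hε => ?_, ⟨fun n => n / 12, fun n => 2 * (n + 2), ?_, ?_,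
    fun n => ?_⟩, fun n T hT => hT.two_mul_le_diam_add_one⟩
  · obtain ⟨S, hS, hS', hd⟩ := exists_areCISTs_hypercube (k := k) (n := n) (by omega)
    exact ⟨S, hS, hS', fun T hT => (hd T hT).trans (by omega)⟩
  -- Since `k ^ 2 ≤ n`, AM-GM bounds `18 k` by `ε n / 2 + 162 / ε`; the other `ε n / 2` absorbs the
  -- constants.
  · refine ⟨⌈(162 / ε + 22) / (ε / 2)⌉₊, fun k n _ h hn => ?_⟩
    have h1 : (162 / ε + 22) ≤ n * (ε / 2) := (div_le_iff₀ (by positivity)).1 (Nat.ceil_le.1 hn)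
    have h2 : ((k ^ 2 : ℕ) : ℝ) ≤ n := by
      have := sq_le_two_mul_two_pow k
      exact_mod_cast (by omega : k ^ 2 ≤ n)
    push_cast at h2
    have h3 : 18 * (k : ℝ) ≤ ε / 2 * k ^ 2 + 162 / ε := by
      have h4 : ε / 2 * k ^ 2 + 162 / ε - 18 * (k : ℝ) = (ε * k - 18) ^ 2 / (2 * ε) := by
        field_simp
        ring
      have h5 : 0 ≤ (ε * k - 18) ^ 2 / (2 * ε) := by positivity
      linarith
    nlinarith
  · have h := (tendsto_nat_floor_mul_div_atTop (R := ℝ) (a := 1 / 12) (by norm_num)).comp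
      tendsto_natCast_atTop_atTop
    refine h.congr fun n => ?_
    have h1 : ⌊(1 / 12 : ℝ) * n⌋₊ = n / 12 := by
      rw [one_div_mul_eq_div]
      exact_mod_cast Nat.floor_div_eq_div (K := ℝ) n 12
    simp only [Function.comp_apply, h1]
  · have h : Tendsto (fun n : ℕ => 2 + 4 / (n : ℝ)) atTop (𝓝 (2 + 0)) :=
      tendsto_const_nhds.add (tendsto_const_div_atTop_nhds_zero_nat 4)
    rw [add_zero] at h
    refine h.congr' ?_
    filter_upwards [eventually_gt_atTop 0] with n hn
    have : (n : ℝ) ≠ 0 := by positivity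
    push_cast
    field_simp
    ring
  · rcases Nat.eq_zero_or_pos (n / 12) with h0 | hpos
    · exact ⟨∅, by simp [h0], by simp [AreCISTs], by simp⟩
    -- Rounding `n / 12` up to a power of two less than doubles it, leaving room as `8 < 12`;
    -- surplus trees are discarded.
    · have h1 : n / 12 ≤ 2 ^ Nat.clog 2 (n / 12) := Nat.le_pow_clog one_lt_two _
      have h2 : 4 * 2 ^ Nat.clog 2 (n / 12) + 1 ≤ n := by
        rcases Nat.lt_or_ge 1 (n / 12) with h | h
        · have h3 := Nat.pow_pred_clog_lt_self one_lt_two h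
          have h4 := Nat.clog_pos one_lt_two h
          obtain ⟨m, hm⟩ : ∃ m, Nat.clog 2 (n / 12) = m + 1 := ⟨_, (Nat.succ_pred h4.ne').symm⟩
          rw [hm] at h3 ⊢
          rw [Nat.pred_succ] at h3
          rw [pow_succ]
          omega
        · have : n / 12 = 1 := by omega
          rw [this]
          simp
          omega
      obtain ⟨S, hS, ⟨hS₁, hS₂⟩, hd⟩ := exists_areCISTs_hypercube h2
      obtain ⟨S', hsub, hS'⟩ := Finset.exists_subset_card_eq (hS ▸ h1 : n / 12 ≤ S.card)
      exact ⟨S', hS', ⟨fun T hT => hS₁ T (hsub hT),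
        fun T₁ h₁ T₂ h₂ => hS₂ T₁ (hsub h₁) T₂ (hsub h₂)⟩, fun T hT => hd T (hsub hT)⟩
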